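/- All graphs are finite and simple. For a graph $G$ let $I(G,x)=\sum_{k\ge 0} s(G,k)x^k$ be its independence polynomial, where $s(G,k)$ is the number of independent sets of $G$ with exactly $k$ vertices (so $s(G,0)=1$), and let $\xi(G)$ be the largest real root of $I(G,x)$. Write $G\succeq H$ if $I(H,x)\ge I(G,x)$ for every $x\in[\xi(G),0]$. Let $n\ge 1$ and let $T$ be a tree of order $n$. Let $S_n=K_{1,n-1}$ be the star and $P_n$ the path of order $n$. Then the largest real roots $\xi(S_n)$, $\xi(T)$ and $\xi(P_n)$ exist, and $$S_n\succeq T\succeq P_n .$$ Moreover, $I(S_n,x)=I(T,x)$ if and only if $T$ is isomorphic to $S_n$, and $I(T,x)=I(P_n,x)$ if and only if $T$ is isomorphic to $P_n$. In particular, $\xi(S_n)\ge\xi(T)\ge\xi(P_n)$. -/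

import Mathlib

open Polynomial

namespace SimpleGraph

/-- The number `s(G, k)` of independent sets of `G` with exactly `k` vertices. -/
noncomputable def numIndepSets {V : Type*} [Fintype V] (G : SimpleGraph V) (k : ℕ) : ℕ :=
  open Classical in (Finset.univ.filter fun s : Finset V => G.IsNIndepSet k s).card

/-- The independence polynomial `I(G, x) = ∑ k, s(G, k) x ^ k`, with `k` from `0` to the order
of `G`, as a polynomial with real coefficients. -/
noncomputable def indepPoly {V : Type*} [Fintype V] (G : SimpleGraph V) : ℝ[X] :=
  ∑ k ∈ Finset.range (Fintype.card V + 1), C (G.numIndepSets k : ℝ) * X ^ k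

/-- `ξ(G)`, the largest real root of `I(G, x)`. The set of roots is finite, so the supremum is
the largest root as soon as there is a real root. -/
noncomputable def xi {V : Type*} [Fintype V] (G : SimpleGraph V) : ℝ :=
  sSup {x : ℝ | G.indepPoly.IsRoot x}

/-- `G ⪰ H`: `I(H, x) ≥ I(G, x)` for every `x` in `[ξ(G), 0]`. -/
def IndepGE {V W : Type*} [Fintype V] [Fintype W] (G : SimpleGraph V) (H : SimpleGraph W) :
    Prop :=
  ∀ x ∈ Set.Icc G.xi 0, G.indepPoly.eval x ≤ H.indepPoly.eval x

/-- The star `S_n = K_{1, n-1}` of order `n` (meaningful for `n ≥ 1`). -/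
abbrev starOfOrder (n : ℕ) : SimpleGraph (Fin 1 ⊕ Fin (n - 1)) :=
  completeBipartiteGraph (Fin 1) (Fin (n - 1))

end SimpleGraph

/-!
# Independence polynomials of trees

Among the trees of given order, the star is the maximum and the path the minimum for the order
`⪰` on independence polynomials.
-/

namespace SimpleGraph

/-! ### Weighted independence sums -/

/-! Everything rests on deleting a vertex: I(U) = I(U - v) + x I(U - N[v]). If I(G) is positive on
[x, 0], so is I of every induced subgraph (`eval_indepPolyOn_pos_of_subset`), so on (ξ(T), 0] all
subforests of T have positive values, and for x ≤ 0 deleting vertices can only increase a value. A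
tree is grown by adding leaves, with I(U + v) = I(U) + x I(U - u) for a leaf v at u.

Star: I(U - u) ≤ (1 + x)^(|U| - 1), so each leaf step preserves the lower bound (1 + x)^(|U| - 1) +
x (`LeafBuilt.pow_add_le_eval`).

Path: leaves are contracted into their neighbours in reverse order, each vertex carrying as weights
the two values of the rooted tree absorbed so far. The invariant `PathDominated` says that replacing
this rooted tree by a path of the same size, attached at an end, does not lower the total. It
survives a contraction (`PathDominated.graft`) because two paths hanging at one vertex can be merged
into one (`pathPoly_merge_le`).

Equality is read off the coefficient of x^3. A leaf at u adds to it a quantity that depends only on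
|U| and, increasingly, on the degree of u in U. Degree |U| - 1 is extremal for the star, degree 1
(once |U| ≥ 2) for the path. -/

open Classical in
/-- The sum over the independent subsets `S` of `U` of the products of the weights `b v` for
`v ∈ S` and `a v` for `v ∈ U \ S`. -/
noncomputable def indepSum {V R : Type*} [DecidableEq V] [CommRing R] (G : SimpleGraph V)
    (a b : V → R) (U : Finset V) : R :=
  ∑ S ∈ U.powerset, if G.IsIndepSet (S : Set V) then (∏ v ∈ S, b v) * ∏ v ∈ U \ S, a v else 0

section IndepSum

variable {V R : Type*} [DecidableEq V] [CommRing R] {G : SimpleGraph V} {a b : V → R}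

@[simp]
lemma indepSum_empty : G.indepSum a b ∅ = 1 := by
  simp [indepSum]

lemma isIndepSet_insert_iff {v : V} {S : Finset V} (hv : v ∉ S) :
    G.IsIndepSet ((insert v S : Finset V) : Set V) ↔
      G.IsIndepSet (S : Set V) ∧ ∀ w ∈ S, ¬ G.Adj v w := by
  have : Std.Symm fun x y => ¬ G.Adj x y := ⟨fun x y h h' => h h'.symm⟩
  rw [Finset.coe_insert, IsIndepSet, Set.pairwise_insert_of_symm_of_notMem (by simpa using hv)]
  simp

-- Split by whether v is chosen. Choosing v forces its neighbours out of the set, and these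
-- contribute their weights `a`.
open Classical in
lemma indepSum_insert {v : V} {U : Finset V} (hv : v ∉ U) :
    G.indepSum a b (insert v U) = a v * G.indepSum a b U +
      b v * (∏ w ∈ U with G.Adj v w, a w) * G.indepSum a b {w ∈ U | ¬ G.Adj v w} := by
  rw [indepSum, Finset.sum_powerset_insert hv]
  congr 1
  · rw [indepSum, Finset.mul_sum]
    refine Finset.sum_congr rfl fun S hS => ?_
    have hvS : v ∉ S := fun h => hv (Finset.mem_powerset.1 hS h)
    have hvU : v ∉ U \ S := fun h => hv (Finset.mem_sdiff.1 h).1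
    rw [Finset.insert_sdiff_of_notMem _ hvS, Finset.prod_insert hvU, mul_ite, mul_zero]
    congr 1
    ring
  · rw [indepSum, Finset.mul_sum]
    symm
    refine Finset.sum_subset_zero_on_sdiff (Finset.powerset_mono.2 (Finset.filter_subset _ _))
      (fun S hS => ?_) fun S hS => ?_
    · obtain ⟨h1, h2⟩ := Finset.mem_sdiff.1 hS
      rw [Finset.mem_powerset] at h1 h2
      have hvS : v ∉ S := fun h => hv (h1 h)
      rw [if_neg]
      rw [isIndepSet_insert_iff hvS]
      rintro ⟨-, h⟩
      exact h2 fun w hw => Finset.mem_filter.2 ⟨h1 hw, h w hw⟩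
    · have hS' := Finset.mem_powerset.1 hS
      have hSU : S ⊆ U := hS'.trans (Finset.filter_subset _ _)
      have hvS : v ∉ S := fun h => hv (hSU h)
      have hN : ∀ w ∈ S, ¬ G.Adj v w := fun w hw => (Finset.mem_filter.1 (hS' hw)).2
      simp only [isIndepSet_insert_iff hvS]
      rw [Finset.prod_insert hvS,
        Finset.insert_sdiff_insert, Finset.sdiff_insert_of_notMem hv]
      have hsplit : (U \ S) = {w ∈ U | G.Adj v w} ∪ ({w ∈ U | ¬ G.Adj v w} \ S) := by
        ext w
        simp only [Finset.mem_sdiff, Finset.mem_union, Finset.mem_filter]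
        have := hN w
        tauto
      have hdis : Disjoint {w ∈ U | G.Adj v w} ({w ∈ U | ¬ G.Adj v w} \ S) := by
        rw [Finset.disjoint_left]
        simp +contextual
      rw [hsplit, Finset.prod_union hdis]
      by_cases h : G.IsIndepSet (S : Set V)
      · rw [if_pos h, if_pos ⟨h, hN⟩]
        ring
      · rw [if_neg h, if_neg (fun h' => h h'.1), mul_zero]

lemma indepSum_insert_leaf {u v : V} {U : Finset V} (hu : u ∈ U) (hv : v ∉ U)
    (huv : ∀ w ∈ U, G.Adj v w ↔ w = u) :
    G.indepSum a b (insert v U) =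
      a v * G.indepSum a b U + b v * a u * G.indepSum a b (U.erase u) := by
  classical
  have h1 : {w ∈ U | G.Adj v w} = {u} := by
    ext w
    simp only [Finset.mem_filter, Finset.mem_singleton]
    exact ⟨fun h => (huv w h.1).1 h.2, fun h => by subst h; exact ⟨hu, (huv w hu).2 rfl⟩⟩
  have h2 : {w ∈ U | ¬ G.Adj v w} = U.erase u := by
    ext w
    simp only [Finset.mem_filter, Finset.mem_erase]
    constructor
    · exact fun h => ⟨fun h' => h.2 ((huv w h.1).2 h'), h.1⟩
    · exact fun h => ⟨h.2, fun h' => h.1 ((huv w h.2).1 h')⟩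
  rw [indepSum_insert hv, h1, h2, Finset.prod_singleton]

@[simp]
lemma indepSum_singleton (v : V) : G.indepSum a b {v} = a v + b v := by
  classical
  have := indepSum_insert (G := G) (a := a) (b := b) (Finset.notMem_empty v)
  simpa using this

lemma indepSum_congr {a' b' : V → R} {U : Finset V} (ha : ∀ v ∈ U, a v = a' v)
    (hb : ∀ v ∈ U, b v = b' v) : G.indepSum a b U = G.indepSum a' b' U := by
  classical
  refine Finset.sum_congr rfl fun S hS => ?_
  have hS := Finset.mem_powerset.1 hS
  congr 2
  · exact Finset.prod_congr rfl fun v hv => hb v (hS hv)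
  · exact Finset.prod_congr rfl fun v hv => ha v (Finset.mem_sdiff.1 hv).1

/-- Contracting a leaf `v` into its neighbour `u`. -/
lemma indepSum_contract_leaf {u v : V} {U : Finset V} (hu : u ∈ U) (hv : v ∉ U)
    (huv : ∀ w ∈ U, G.Adj v w ↔ w = u) :
    G.indepSum (Function.update a u (a u * (a v + b v))) (Function.update b u (b u * a v)) U =
      G.indepSum a b (insert v U) := by
  classical
  set a' := Function.update a u (a u * (a v + b v)) with ha'
  set b' := Function.update b u (b u * a v) with hb'
  -- The weights change only at u, so expanding both sides at u leaves identical sums away from u.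
  have key : ∀ U' ⊆ U.erase u, G.indepSum a' b' U' = G.indepSum a b U' := fun U' hU' =>
    indepSum_congr
      (fun w hw => Function.update_of_ne (Finset.ne_of_mem_erase (hU' hw)) _ _)
      (fun w hw => Function.update_of_ne (Finset.ne_of_mem_erase (hU' hw)) _ _)
  have hu' : u ∉ U.erase u := Finset.notMem_erase u U
  have hprod : ∏ w ∈ U.erase u with G.Adj u w, a' w = ∏ w ∈ U.erase u with G.Adj u w, a w :=
    Finset.prod_congr rfl fun w hw =>
      Function.update_of_ne (Finset.ne_of_mem_erase (Finset.mem_filter.1 hw).1) _ _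
  have h1 := indepSum_insert (G := G) (a := a) (b := b) hu'
  have h2 := indepSum_insert (G := G) (a := a') (b := b') hu'
  rw [Finset.insert_erase hu] at h1 h2
  rw [indepSum_insert_leaf hu hv huv, h2, h1, hprod, key _ subset_rfl,
    key _ (Finset.filter_subset _ _)]
  simp only [ha', hb', Function.update_self]
  ring

lemma map_indepSum {R' : Type*} [CommRing R'] (f : R →+* R') (U : Finset V) :
    f (G.indepSum a b U) = G.indepSum (f ∘ a) (f ∘ b) U := by
  classical
  simp only [indepSum, map_sum, apply_ite f, map_mul, map_prod, map_zero, Function.comp]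

end IndepSum

/-! ### Independence polynomials of vertex sets -/

/-- The independence polynomial of the subgraph of `G` induced by `U`. -/
noncomputable def indepPolyOn {V : Type*} [DecidableEq V] (G : SimpleGraph V) (U : Finset V) :
    ℝ[X] :=
  G.indepSum (fun _ => 1) (fun _ => X) U

lemma indepPoly_eq_indepPolyOn {V : Type*} [Fintype V] [DecidableEq V] (G : SimpleGraph V) :
    G.indepPoly = G.indepPolyOn Finset.univ := by
  classical
  simp only [indepPoly, indepPolyOn, indepSum, numIndepSets, Finset.prod_const,
    one_pow, mul_one, Finset.powerset_univ]
  rw [← Finset.sum_filter, ← Finset.sum_fiberwise_of_maps_to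
    (s := Finset.univ.filter fun S : Finset V => G.IsIndepSet (S : Set V))
    (t := Finset.range (Fintype.card V + 1)) (g := Finset.card)
    (fun S _ => Finset.mem_range.2 (Nat.lt_succ_of_le (Finset.card_le_univ S)))]
  refine Finset.sum_congr rfl fun k _ => ?_
  rw [Finset.sum_congr rfl (g := fun _ => X ^ k)
    (fun S hS => by rw [(Finset.mem_filter.1 hS).2]), Finset.sum_const, nsmul_eq_mul,
    Finset.filter_filter]
  simp only [isNIndepSet_iff, map_natCast]

lemma indepPoly_congr {V W : Type*} [Fintype V] [Fintype W] {G : SimpleGraph V}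
    {H : SimpleGraph W} (e : G ≃g H) : G.indepPoly = H.indepPoly := by
  classical
  have hc : Fintype.card V = Fintype.card W := Fintype.card_congr e.toEquiv
  have key : ∀ k, G.numIndepSets k = H.numIndepSets k := by
    intro k
    refine Finset.card_bij (fun s _ => s.map e.toEquiv.toEmbedding) ?_ ?_ ?_
    · intro s hs
      simp only [Finset.mem_filter, Finset.mem_univ, true_and, isNIndepSet_iff,
        Finset.card_map] at hs ⊢
      refine ⟨?_, hs.2⟩
      intro x hx y hy hxy hadj
      simp only [Finset.coe_map, Set.mem_image] at hx hy
      obtain ⟨x, hx, rfl⟩ := hx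
      obtain ⟨y, hy, rfl⟩ := hy
      exact hs.1 hx hy (fun h => hxy (by rw [h])) (e.map_adj_iff.1 hadj)
    · intro s _ t _ h
      exact Finset.map_injective _ h
    · intro t ht
      simp only [Finset.mem_filter, Finset.mem_univ, true_and, isNIndepSet_iff] at ht
      refine ⟨t.map e.symm.toEquiv.toEmbedding, ?_, ?_⟩
      · simp only [Finset.mem_filter, Finset.mem_univ, true_and, isNIndepSet_iff,
          Finset.card_map]
        refine ⟨?_, ht.2⟩
        intro x hx y hy hxy hadj
        simp only [Finset.coe_map, Set.mem_image] at hx hy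
        obtain ⟨x, hx, rfl⟩ := hx
        obtain ⟨y, hy, rfl⟩ := hy
        exact ht.1 hx hy (fun h => hxy (by rw [h])) (e.symm.map_adj_iff.1 hadj)
      · ext x
        simp only [Finset.mem_map_equiv]
        exact iff_of_eq (congrArg (· ∈ t) (e.apply_symm_apply x))
  simp only [indepPoly, hc, key]

section IndepPolyOn

variable {V : Type*} [DecidableEq V] {G : SimpleGraph V}

@[simp]
lemma indepPolyOn_empty : G.indepPolyOn ∅ = 1 := indepSum_empty

@[simp]
lemma indepPolyOn_singleton (v : V) : G.indepPolyOn {v} = 1 + X := indepSum_singleton v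

open Classical in
lemma indepPolyOn_insert {v : V} {U : Finset V} (hv : v ∉ U) :
    G.indepPolyOn (insert v U) =
      G.indepPolyOn U + X * G.indepPolyOn {w ∈ U | ¬ G.Adj v w} := by
  rw [indepPolyOn, indepSum_insert hv]
  simp [indepPolyOn]

lemma indepPolyOn_insert_leaf {u v : V} {U : Finset V} (hu : u ∈ U) (hv : v ∉ U)
    (huv : ∀ w ∈ U, G.Adj v w ↔ w = u) :
    G.indepPolyOn (insert v U) = G.indepPolyOn U + X * G.indepPolyOn (U.erase u) := by
  rw [indepPolyOn, indepSum_insert_leaf hu hv huv]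
  simp [indepPolyOn]

lemma eval_indepPolyOn (x : ℝ) (U : Finset V) :
    (G.indepPolyOn U).eval x = G.indepSum (fun _ => 1) (fun _ => x) U := by
  rw [indepPolyOn, ← coe_evalRingHom, map_indepSum]
  congr 1 <;> ext <;> simp

lemma one_le_eval_indepPolyOn {x : ℝ} (hx : 0 ≤ x) (U : Finset V) :
    1 ≤ (G.indepPolyOn U).eval x := by
  classical
  rw [eval_indepPolyOn, indepSum]
  refine le_trans ?_ (Finset.single_le_sum (fun S _ => ?_) (Finset.empty_mem_powerset U))
  · simp
  · split_ifs <;> simp; positivity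

lemma eval_zero_indepPolyOn (U : Finset V) : (G.indepPolyOn U).eval 0 = 1 := by
  classical
  induction U using Finset.induction_on with
  | empty => simp
  | insert v U hv ih => simp [indepPolyOn_insert hv, ih]

end IndepPolyOn

end SimpleGraph

namespace SimpleGraph

/-! ### Positivity of the independence polynomial and its largest root -/

section Positivity

variable {V : Type*} [DecidableEq V] {G : SimpleGraph V}

open Classical in
lemma indepPolyOn_eq_erase_add {v : V} {U : Finset V} (hv : v ∈ U) :
    G.indepPolyOn U = G.indepPolyOn (U.erase v) +
      X * G.indepPolyOn {w ∈ U.erase v | ¬ G.Adj v w} := by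
  rw [← indepPolyOn_insert (Finset.notMem_erase v U), Finset.insert_erase hv]

/-- If the independence polynomial is positive on `[x, 0]`, then so are those of the induced
subgraphs. -/
lemma eval_indepPolyOn_pos_of_subset {U W : Finset V} (hWU : W ⊆ U) {x : ℝ}
    (hU : ∀ y ∈ Set.Icc x 0, 0 < (G.indepPolyOn U).eval y) :
    ∀ y ∈ Set.Icc x 0, 0 < (G.indepPolyOn W).eval y := by
  classical
  induction U using Finset.strongInduction generalizing W x with
  | H U ih =>
  rcases hWU.eq_or_ssubset with rfl | hlt
  · exact hU
  obtain ⟨v, hvU, hvW⟩ := Finset.exists_of_ssubset hlt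
  have hWe : W ⊆ U.erase v := Finset.subset_erase.2 ⟨hWU, hvW⟩
  have hss : U.erase v ⊂ U := Finset.erase_ssubset hvU
  refine ih _ hss hWe ?_
  by_contra! hcon
  -- At the greatest point z of [x, 0] where `f` is not positive, induction on (z, 0] and continuity
  -- give `g` ≥ 0. Hence I(U) = f + z g ≤ 0 at z, a contradiction.
  set f := G.indepPolyOn (U.erase v) with hf
  set Z : Set ℝ := {y ∈ Set.Icc x 0 | f.eval y ≤ 0} with hZ
  have hZc : IsCompact Z := isCompact_Icc.inter_right
    (isClosed_le f.continuous continuous_const)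
  obtain ⟨z, ⟨hz, hz0⟩, hmax⟩ := hZc.exists_isGreatest (by
    obtain ⟨y, hy, hy0⟩ := hcon
    exact ⟨y, hy, hy0⟩)
  have hzlt : z < 0 := by
    rcases hz.2.eq_or_lt with h | h
    · rw [h, hf, eval_zero_indepPolyOn] at hz0
      linarith
    · exact h
  have hpos : ∀ y ∈ Set.Ioc z 0, 0 < f.eval y := by
    intro y hy
    by_contra! h
    exact absurd (hmax ⟨⟨hz.1.trans hy.1.le, hy.2⟩, h⟩) (not_le.2 hy.1)
  set g := G.indepPolyOn {w ∈ U.erase v | ¬ G.Adj v w} with hg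
  have hgpos : ∀ y ∈ Set.Ioc z 0, 0 < g.eval y := by
    intro y hy
    exact ih _ hss (Finset.filter_subset _ _)
      (fun y' hy' => hpos y' ⟨hy.1.trans_le hy'.1, hy'.2⟩) y ⟨le_rfl, hy.2⟩
  have hgz : 0 ≤ g.eval z := by
    have hmem : z ∈ closure (Set.Ioc z 0) := by
      rw [closure_Ioc hzlt.ne]
      exact ⟨le_rfl, hzlt.le⟩
    exact closure_minimal (fun y hy => (hgpos y hy).le)
      (isClosed_le continuous_const g.continuous) hmem
  have h1 := hU z hz
  rw [indepPolyOn_eq_erase_add hvU, eval_add, eval_mul, eval_X] at h1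
  linarith [mul_nonpos_of_nonpos_of_nonneg hzlt.le hgz]

end Positivity

section Roots

variable {V : Type*} [Fintype V] (G : SimpleGraph V)

lemma indepPoly_ne_zero : G.indepPoly ≠ 0 := by
  classical
  intro h
  have := eval_zero_indepPolyOn (G := G) Finset.univ
  rw [← indepPoly_eq_indepPolyOn, h] at this
  simp at this

/-- Without a root the polynomial would be positive on [-1, 0], hence so would 1 + x, the polynomial
of a single vertex; but this vanishes at -1. -/
lemma exists_isRoot_indepPoly [Nonempty V] : ∃ x, G.indepPoly.IsRoot x := by
  classical
  by_contra! hno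
  obtain ⟨v⟩ := ‹Nonempty V›
  have hpos : ∀ y ∈ Set.Icc (-1 : ℝ) 0, 0 < (G.indepPolyOn Finset.univ).eval y := by
    rw [← indepPoly_eq_indepPolyOn]
    intro y hy
    by_contra! hle
    have h0 : G.indepPoly.eval 0 = 1 := by
      rw [indepPoly_eq_indepPolyOn, eval_zero_indepPolyOn]
    obtain ⟨z, -, hz⟩ := intermediate_value_Icc hy.2 G.indepPoly.continuous.continuousOn
      (show (0 : ℝ) ∈ Set.Icc _ _ from ⟨hle, by rw [h0]; exact zero_le_one⟩)
    exact hno z hz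
  have := eval_indepPolyOn_pos_of_subset (Finset.subset_univ {v}) hpos (-1) (by simp)
  simp at this

/-- The largest real root of the independence polynomial exists. -/
lemma isGreatest_xi [Nonempty V] : IsGreatest {x : ℝ | G.indepPoly.IsRoot x} G.xi := by
  have hfin : {x : ℝ | G.indepPoly.IsRoot x}.Finite :=
    Polynomial.finite_setOfPred_isRoot G.indepPoly_ne_zero
  exact ⟨Set.Nonempty.csSup_mem G.exists_isRoot_indepPoly hfin,
    fun x hx => le_csSup hfin.bddAbove hx⟩

lemma xi_neg [Nonempty V] : G.xi < 0 := by
  classical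
  by_contra! h
  have h1 := one_le_eval_indepPolyOn (G := G) h Finset.univ
  have h2 : G.indepPoly.eval G.xi = 0 := G.isGreatest_xi.1
  rw [← indepPoly_eq_indepPolyOn, h2] at h1
  linarith

lemma eval_indepPoly_pos [Nonempty V] {x : ℝ} (hx : G.xi < x) : 0 < G.indepPoly.eval x := by
  classical
  rcases le_total 0 x with h0 | h0
  · rw [indepPoly_eq_indepPolyOn]
    exact zero_lt_one.trans_le (one_le_eval_indepPolyOn h0 _)
  by_contra! hle
  have h0' : G.indepPoly.eval 0 = 1 := by
    rw [indepPoly_eq_indepPolyOn, eval_zero_indepPolyOn]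
  obtain ⟨z, hz, hz0⟩ := intermediate_value_Icc h0 G.indepPoly.continuous.continuousOn
    (show (0 : ℝ) ∈ Set.Icc _ _ from ⟨hle, by rw [h0']; exact zero_le_one⟩)
  exact absurd (G.isGreatest_xi.2 hz0) (not_le.2 (hx.trans_le hz.1))

/-- Above the largest root, the independence polynomials of all induced subgraphs are
positive. -/
lemma eval_indepPolyOn_pos [DecidableEq V] [Nonempty V] {x : ℝ} (hx : G.xi < x) (hx0 : x ≤ 0)
    (U : Finset V) : 0 < (G.indepPolyOn U).eval x := by
  refine eval_indepPolyOn_pos_of_subset (Finset.subset_univ U) (x := x) (fun y hy => ?_) x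
    ⟨le_rfl, hx0⟩
  rw [← indepPoly_eq_indepPolyOn]
  exact G.eval_indepPoly_pos (hx.trans_le hy.1)

variable {G}
variable {W : Type*} [Fintype W] {H : SimpleGraph W}

/-- Positivity of induced subgraphs is available only strictly above the root; the endpoint follows
by continuity. -/
lemma IndepGE.of_Ioc [Nonempty V]
    (h : ∀ x ∈ Set.Ioc G.xi 0, G.indepPoly.eval x ≤ H.indepPoly.eval x) : G.IndepGE H := by
  intro x hx
  rw [← closure_Ioc G.xi_neg.ne] at hx
  exact closure_minimal h (isClosed_le G.indepPoly.continuous H.indepPoly.continuous) hx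

lemma IndepGE.xi_le [Nonempty V] [Nonempty W] (h : G.IndepGE H) : H.xi ≤ G.xi := by
  by_contra! hlt
  have h1 := h H.xi ⟨hlt.le, H.xi_neg.le⟩
  have h2 : H.indepPoly.eval H.xi = 0 := H.isGreatest_xi.1
  linarith [G.eval_indepPoly_pos hlt]

/-- It suffices to compare on the domain of the smaller graph, provided that the inequality
holds there. -/
lemma IndepGE.of_Ioc_right [Nonempty V] [Nonempty W]
    (h : ∀ x ∈ Set.Ioc H.xi 0, G.indepPoly.eval x ≤ H.indepPoly.eval x) : G.IndepGE H := by
  have hcl : ∀ x ∈ Set.Icc H.xi 0, G.indepPoly.eval x ≤ H.indepPoly.eval x := by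
    intro x hx
    rw [← closure_Ioc H.xi_neg.ne] at hx
    exact closure_minimal h (isClosed_le G.indepPoly.continuous H.indepPoly.continuous) hx
  have hxi : H.xi ≤ G.xi := by
    by_contra! hlt
    have h1 := hcl H.xi ⟨le_rfl, H.xi_neg.le⟩
    have h2 : H.indepPoly.eval H.xi = 0 := H.isGreatest_xi.1
    linarith [G.eval_indepPoly_pos hlt]
  exact fun x hx => hcl x ⟨hxi.trans hx.1, hx.2⟩

end Roots

/-! ### Building trees by adding leaves -/

/-- The vertex sets that arise from a single vertex by successively adding a vertex with exactly
one neighbour in the set built so far. -/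
inductive LeafBuilt {V : Type*} [DecidableEq V] (G : SimpleGraph V) : Finset V → Prop
  | single (v : V) : LeafBuilt G {v}
  | addLeaf {U : Finset V} {u v : V} : LeafBuilt G U → u ∈ U → v ∉ U →
      (∀ w ∈ U, G.Adj v w ↔ w = u) → LeafBuilt G (insert v U)

lemma LeafBuilt.map {V W : Type*} [DecidableEq V] [DecidableEq W] {G : SimpleGraph V}
    {H : SimpleGraph W} (f : G ↪g H) {U : Finset V} (h : G.LeafBuilt U) :
    H.LeafBuilt (U.map f.toEmbedding) := by
  induction h with
  | single v => rw [Finset.map_singleton]; exact .single _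
  | @addLeaf U u v _ hu hv huv ih =>
    rw [Finset.map_insert]
    refine .addLeaf ih (Finset.mem_map_of_mem _ hu) (by simpa using hv) fun w hw => ?_
    obtain ⟨w, hwU, rfl⟩ := Finset.mem_map.1 hw
    exact f.map_adj_iff.trans ((huv w hwU).trans f.injective.eq_iff.symm)

/-- Removing a vertex of degree one leaves a smaller tree, to which that vertex is added back last.
-/
lemma IsTree.leafBuilt_univ {V : Type*} [Fintype V] [DecidableEq V] {G : SimpleGraph V}
    (hG : G.IsTree) : G.LeafBuilt Finset.univ := by
  classical
  induction hn : Fintype.card V generalizing V with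
  | zero =>
    have := hG.connected.nonempty
    exact absurd hn Fintype.card_ne_zero
  | succ n ih =>
  rcases subsingleton_or_nontrivial V with hs | hnt
  · obtain ⟨v⟩ := hG.connected.nonempty
    rw [show (Finset.univ : Finset V) = {v} from by ext w; simp [Subsingleton.elim w v]]
    exact .single v
  · obtain ⟨v, hv⟩ := hG.exists_vert_degree_one_of_nontrivial
    have hT : (G.induce {v}ᶜ).IsTree :=
      ⟨hG.connected.induce_compl_singleton_of_degree_eq_one hv, hG.isAcyclic.induce _⟩
    have hcard : Fintype.card ({v}ᶜ : Set V) = n := by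
      rw [Fintype.card_compl_set]; simp [hn]
    have h := (ih hT hcard).map (Embedding.induce _)
    obtain ⟨u, hu, huniq⟩ := degree_eq_one_iff_existsUnique_adj.1 hv
    set U := (Finset.univ : Finset ({v}ᶜ : Set V)).map
      (Embedding.induce (G := G) ({v}ᶜ : Set V)).toEmbedding with hU
    have hmem : ∀ w, w ∈ U ↔ w ≠ v := by
      intro w
      simp [hU, Embedding.induce]
    have huniv : Finset.univ = insert v U := by
      ext w
      simp [hmem, em]
    rw [huniv]
    refine h.addLeaf ((hmem u).2 hu.ne') (by simp [hmem]) fun w _ => ⟨huniq w, ?_⟩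
    rintro rfl
    exact hu

end SimpleGraph

namespace SimpleGraph

/-! ### Stars -/

section Star

variable {V : Type*} [DecidableEq V] {G : SimpleGraph V}

lemma indepPolyOn_of_isIndepSet {U : Finset V} (hU : ∀ v ∈ U, ∀ w ∈ U, ¬ G.Adj v w) :
    G.indepPolyOn U = (1 + X) ^ U.card := by
  classical
  induction U using Finset.induction_on with
  | empty => simp
  | insert v U hv ih =>
    have hU' : {w ∈ U | ¬ G.Adj v w} = U := Finset.filter_true_of_mem fun w hw =>
      hU v (Finset.mem_insert_self _ _) w (Finset.mem_insert_of_mem hw)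
    rw [indepPolyOn_insert hv, hU', Finset.card_insert_of_notMem hv, ih fun v hv w hw =>
      hU v (Finset.mem_insert_of_mem hv) w (Finset.mem_insert_of_mem hw)]
    ring

lemma indepPoly_starOfOrder (n : ℕ) : (starOfOrder n).indepPoly = (1 + X) ^ (n - 1) + X := by
  classical
  set L : Finset (Fin 1 ⊕ Fin (n - 1)) := Finset.univ.map Function.Embedding.inr with hL
  have hu : Finset.univ = insert (Sum.inl 0) L := by
    ext w
    rcases w with w | w
    · simp [Subsingleton.elim w 0]
    · simp [hL]
  have hind : (starOfOrder n).indepPolyOn L = (1 + X) ^ (n - 1) := by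
    rw [indepPolyOn_of_isIndepSet]
    · simp [hL]
    · intro v hv w hw
      obtain ⟨v, -, rfl⟩ := Finset.mem_map.1 hv
      obtain ⟨w, -, rfl⟩ := Finset.mem_map.1 hw
      simp
  have hN : {w ∈ L | ¬ (starOfOrder n).Adj (Sum.inl 0) w} = ∅ := by
    rw [Finset.filter_eq_empty_iff]
    intro w hw
    obtain ⟨w, -, rfl⟩ := Finset.mem_map.1 hw
    simp
  rw [indepPoly_eq_indepPolyOn, hu, indepPolyOn_insert (by simp [hL]), hN, hind]
  simp

variable {x : ℝ}

lemma eval_indepPolyOn_anti (hx : x ≤ 0) {U W : Finset V} (hWU : W ⊆ U)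
    (hpos : ∀ U' ⊆ U, 0 < (G.indepPolyOn U').eval x) :
    (G.indepPolyOn U).eval x ≤ (G.indepPolyOn W).eval x := by
  classical
  induction U using Finset.strongInduction generalizing W with
  | H U ih =>
  rcases hWU.eq_or_ssubset with rfl | hlt
  · exact le_rfl
  obtain ⟨v, hvU, hvW⟩ := Finset.exists_of_ssubset hlt
  refine le_trans ?_ (ih _ (Finset.erase_ssubset hvU) (Finset.subset_erase.2 ⟨hWU, hvW⟩)
    fun U' hU' => hpos U' (hU'.trans (Finset.erase_subset _ _)))
  rw [indepPolyOn_eq_erase_add hvU, eval_add, eval_mul, eval_X]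
  linarith [mul_nonpos_of_nonpos_of_nonneg hx (hpos {w ∈ U.erase v | ¬ G.Adj v w}
    ((Finset.filter_subset _ _).trans (Finset.erase_subset _ _))).le]

/-- Since I(U - N(v)) ≥ I(U) and x ≤ 0, each added vertex v multiplies the value by at most 1 + x.
-/
lemma eval_indepPolyOn_le_pow (hx : x ≤ 0) {U : Finset V}
    (hpos : ∀ U' ⊆ U, 0 < (G.indepPolyOn U').eval x) :
    (G.indepPolyOn U).eval x ≤ (1 + x) ^ U.card := by
  classical
  induction U using Finset.induction_on with
  | empty => simp
  | insert v U hv ih =>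
    have hpos' : ∀ U' ⊆ U, 0 < (G.indepPolyOn U').eval x := fun U' hU' =>
      hpos U' (hU'.trans (Finset.subset_insert _ _))
    have h1 := ih hpos'
    have h2 := eval_indepPolyOn_anti hx (Finset.filter_subset (fun w => ¬ G.Adj v w) U) hpos'
    have h3 : 0 < 1 + x := by
      simpa using hpos {v} (by simp)
    rw [indepPolyOn_insert hv, Finset.card_insert_of_notMem hv, pow_succ, eval_add, eval_mul,
      eval_X]
    nlinarith [mul_le_mul_of_nonpos_left h2 hx]

lemma LeafBuilt.card_pos {U : Finset V} (h : G.LeafBuilt U) : 0 < U.card := by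
  cases h with
  | single v => simp
  | addLeaf => exact Finset.card_pos.2 ⟨_, Finset.mem_insert_self _ _⟩

/-- Among trees of given order, the star has the smallest values. -/
lemma LeafBuilt.pow_add_le_eval {U : Finset V} (h : G.LeafBuilt U) (hx : x ≤ 0)
    (hpos : ∀ U' ⊆ U, 0 < (G.indepPolyOn U').eval x) :
    (1 + x) ^ (U.card - 1) + x ≤ (G.indepPolyOn U).eval x := by
  induction h with
  | single v => simp
  | @addLeaf U u v hU hu hv huv ih =>
    have hpos' : ∀ U' ⊆ U, 0 < (G.indepPolyOn U').eval x := fun U' hU' =>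
      hpos U' (hU'.trans (Finset.subset_insert _ _))
    have h1 := ih hpos'
    have h2 := eval_indepPolyOn_le_pow hx (U := U.erase u)
      fun U' hU' => hpos' U' (hU'.trans (Finset.erase_subset _ _))
    rw [Finset.card_erase_of_mem hu] at h2
    obtain ⟨m, hm⟩ := Nat.exists_eq_succ_of_ne_zero hU.card_pos.ne'
    rw [indepPolyOn_insert_leaf hu hv huv, Finset.card_insert_of_notMem hv, eval_add, eval_mul,
      eval_X]
    simp only [hm, Nat.succ_eq_add_one, Nat.add_sub_cancel] at h1 h2 ⊢
    rw [pow_succ]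
    nlinarith [mul_le_mul_of_nonpos_left h2 hx]

end Star

/-! ### Paths -/

/-- The independence polynomials of the paths, with the index shifted by one: the polynomial of
the path with `n` vertices is `pathPoly (n + 1)`. -/
noncomputable def pathPoly : ℕ → ℝ[X]
  | 0 => 1
  | 1 => 1
  | n + 2 => pathPoly (n + 1) + X * pathPoly n

lemma indepPoly_pathGraph (n : ℕ) : (pathGraph n).indepPoly = pathPoly (n + 1) := by
  classical
  have key : ∀ k ≤ n, (pathGraph n).indepPolyOn {i | i.val < k} = pathPoly (k + 1) := by
    intro k
    induction k using Nat.strong_induction_on with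
    | _ k ih =>
    match k with
    | 0 => intro _; simp [pathPoly]
    | 1 =>
      intro h
      rw [show ({i | i.val < 1} : Finset (Fin n)) = {⟨0, h⟩} by ext i; simp [Fin.ext_iff]]
      simp [pathPoly]
    | k + 2 =>
      intro h
      have h1 : ({i | i.val < k + 2} : Finset (Fin n)) =
          insert ⟨k + 1, h⟩ (Finset.univ.filter fun i : Fin n => i.val < k + 1) := by
        ext i
        simp only [Finset.mem_filter, Finset.mem_univ, true_and, Finset.mem_insert, Fin.ext_iff]
        omega
      have h2 : (Finset.univ.filter fun i : Fin n => i.val < k + 1).erase ⟨k, by omega⟩ =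
          ({i | i.val < k} : Finset (Fin n)) := by
        ext i
        simp only [Finset.mem_filter, Finset.mem_univ, true_and, Finset.mem_erase, ne_eq,
          Fin.ext_iff]
        omega
      rw [h1, indepPolyOn_insert_leaf (u := (⟨k, by omega⟩ : Fin n)) (by simp) (by simp), h2,
        ih (k + 1) (by omega) (by omega), ih k (by omega) (by omega),
        show pathPoly (k + 2 + 1) = pathPoly (k + 1 + 1) + X * pathPoly (k + 1) by rw [pathPoly]]
      intro w hw
      simp only [Finset.mem_filter, Finset.mem_univ, true_and] at hw
      simp only [pathGraph_adj, Fin.ext_iff]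
      omega
  rw [indepPoly_eq_indepPolyOn, ← key n le_rfl]
  congr 1
  ext i
  simp

/-- Deleting a vertex of a path leaves paths with a and b vertices; choosing it shortens both by
one. The index shift keeps this valid when a or b is 0. -/
lemma pathPoly_add (a b : ℕ) :
    pathPoly (a + b + 2) = pathPoly (a + 1) * pathPoly (b + 1) + X * pathPoly a * pathPoly b := by
  induction b using Nat.strong_induction_on with
  | _ b ih =>
  match b with
  | 0 => simp [pathPoly]
  | 1 => simp only [pathPoly]; ring
  | b + 2 =>
    have h1 : pathPoly (a + b + 4) = pathPoly (a + b + 3) + X * pathPoly (a + b + 2) := by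
      rw [pathPoly]
    have h2 : pathPoly (b + 3) = pathPoly (b + 2) + X * pathPoly (b + 1) := by rw [pathPoly]
    have h3 : pathPoly (b + 2) = pathPoly (b + 1) + X * pathPoly b := by rw [pathPoly]
    have h4 := ih (b + 1) (by omega)
    change pathPoly (a + b + 3) = pathPoly (a + 1) * pathPoly (b + 2) + _ at h4
    change pathPoly (a + b + 4) = pathPoly (a + 1) * pathPoly (b + 3) + _
    rw [h1, h4, ih b (by omega), h2, h3]
    ring

/-- Merging two pendant paths into one. -/
lemma pathPoly_merge_le {x A B : ℝ} (hAB : A ≤ B) (a m : ℕ)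
    (hq : ∀ j ≤ a + m + 2, 0 ≤ (pathPoly j).eval x) :
    (pathPoly (a + 1)).eval x * (pathPoly (m + 2)).eval x * A +
        x * (pathPoly a).eval x * (pathPoly (m + 1)).eval x * B ≤
      (pathPoly (a + m + 2)).eval x * A + x * (pathPoly (a + m + 1)).eval x * B := by
  match a with
  -- One of the two paths is trivial, so the root is already an end and equality holds.
  | 0 => simp [pathPoly]
  | a + 1 =>
    have h1 : 0 ≤ (pathPoly a).eval x := hq a (by omega)
    have h2 : 0 ≤ (pathPoly m).eval x := hq m (by omega)
    rw [pathPoly_add (a + 1) m, show a + 1 + m + 1 = a + m + 2 by ring, pathPoly_add a m,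
      show a + 1 + 1 = a + 2 by ring]
    simp only [pathPoly, eval_add, eval_mul, eval_X]
    -- The right side minus the left is exactly x^2 p_a p_m (B - A), with p_j the value of `pathPoly
    -- j`.
    have := mul_nonneg (mul_nonneg (mul_nonneg (sq_nonneg x) h1) h2) (sub_nonneg.2 hAB)
    linear_combination this

/-- The pair `(α, β)` of values of a rooted tree with `k` edges (without its root, and without its
root and the neighbours of the root) is dominated, in every context `(A, B)`, by that of the path
with `k` edges rooted at an end. -/
structure PathDominated (x : ℝ) (k : ℕ) (α β : ℝ) : Prop where
  left_pos : 0 < α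
  right_pos : 0 < β
  le : ∀ A B, 0 ≤ A → A ≤ B → 0 ≤ α * A + x * β * B →
    α * A + x * β * B ≤ (pathPoly (k + 1)).eval x * A + x * (pathPoly k).eval x * B

lemma pathDominated_zero (x : ℝ) : PathDominated x 0 1 1 where
  left_pos := one_pos
  right_pos := one_pos
  le A B _ _ _ := by simp [pathPoly]

/-- The pair in the conclusion belongs to the tree obtained by joining the two roots by an edge and
keeping the first root. Each tree is replaced by a path in the context formed by the rest, and the
two resulting paths at the kept root are then merged. -/
lemma PathDominated.graft {x α β γ δ : ℝ} {a m : ℕ} (h1 : PathDominated x a α β)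
    (h2 : PathDominated x m γ δ) (hx : x ≤ 0) (hpos : 0 < γ + x * δ)
    (hq : ∀ j ≤ a + m + 2, 0 ≤ (pathPoly j).eval x) :
    PathDominated x (a + m + 1) (α * (γ + x * δ)) (β * γ) where
  left_pos := mul_pos h1.left_pos hpos
  right_pos := mul_pos h1.right_pos h2.left_pos
  le A B hA hAB h0 := by
    have hγ := h2.left_pos
    have hδ := h2.right_pos
    have hxδ : x * δ ≤ 0 := mul_nonpos_of_nonpos_of_nonneg hx hδ.le
    -- Context of the first tree: the outer context together with the second tree, whose root is
    -- available in the first entry and excluded in the second.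
    have e1 := h1.le ((γ + x * δ) * A) (γ * B) (by positivity)
      (by nlinarith [mul_le_mul_of_nonneg_left hAB hγ.le]) (by linarith)
    -- Context of the second tree, once the first is a path: its root is adjacent to the end of that
    -- path, which stays available in A' and is excluded in B'.
    set A' := (pathPoly (a + 1)).eval x * A + x * (pathPoly a).eval x * B with hA'
    set B' := (pathPoly (a + 1)).eval x * A with hB'
    have hB'0 : 0 ≤ B' := mul_nonneg (hq _ (by omega)) hA
    have hA'B' : A' ≤ B' := by
      have : x * (pathPoly a).eval x * B ≤ 0 := mul_nonpos_of_nonpos_of_nonneg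
        (mul_nonpos_of_nonpos_of_nonneg hx (hq _ (by omega))) (hA.trans hAB)
      linarith
    have e2 : α * (γ + x * δ) * A + x * (β * γ) * B ≤ γ * A' + x * δ * B' := by
      rw [hA', hB']
      linarith
    have hA'0 : 0 ≤ A' := by
      have : 0 ≤ γ * A' := by
        linarith [mul_nonpos_of_nonpos_of_nonneg hxδ hB'0]
      exact nonneg_of_mul_nonneg_right this hγ
    have e3 := h2.le A' B' hA'0 hA'B' (h0.trans e2)
    refine e2.trans (e3.trans (le_trans (le_of_eq ?_) (pathPoly_merge_le hAB a m hq)))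
    rw [hA', hB']
    simp only [pathPoly, eval_add, eval_mul, eval_X]
    ring

/-! ### Comparison of a tree with the path -/

section

variable {V : Type*} [DecidableEq V] {G : SimpleGraph V} {x : ℝ}

/-- Vertex v stands for a rooted tree with k v + 1 vertices. Contracting the leaf added last keeps
the total sum and grafts its tree onto that of its neighbour, until a single vertex remains in the
context (1, 1). -/
lemma LeafBuilt.indepSum_le {U : Finset V} (h : G.LeafBuilt U) (hx : x ≤ 0) {k : V → ℕ}
    {a b : V → ℝ} (hpos : ∀ W ⊆ U, 0 < G.indepSum a (fun v => x * b v) W)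
    (hQ : ∀ v ∈ U, PathDominated x (k v) (a v) (b v))
    (hq : ∀ j ≤ ∑ v ∈ U, (k v + 1), 0 ≤ (pathPoly j).eval x) :
    G.indepSum a (fun v => x * b v) U ≤ (pathPoly (∑ v ∈ U, (k v + 1) + 1)).eval x := by
  induction h generalizing k a b with
  | single v =>
    have h0 := hpos {v} subset_rfl
    have h1 := (hQ v (by simp)).le 1 1 zero_le_one le_rfl
    rw [indepSum_singleton] at h0 ⊢
    rw [Finset.sum_singleton]
    simp only [pathPoly, eval_add, eval_mul, eval_X, mul_one] at h1 ⊢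
    exact h1 h0.le
  | @addLeaf U u v hU hu hv huv ih =>
    have huv' : u ≠ v := fun h => hv (h ▸ hu)
    have hmu : u ∈ insert v U := Finset.mem_insert_of_mem hu
    have hmv : v ∈ insert v U := Finset.mem_insert_self _ _
    set k' := Function.update k u (k u + k v + 1) with hk'
    set a' := Function.update a u (a u * (a v + x * b v)) with ha'
    set b' := Function.update b u (b u * a v) with hb'
    have hxb : (fun w => x * b' w) =
        Function.update (fun w => x * b w) u (x * b u * a v) := by
      funext w
      by_cases hw : w = u
      · subst hw; simp [hb', mul_assoc]
      · simp [hb', hw]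
    have hsum : ∑ w ∈ U, (k' w + 1) = ∑ w ∈ insert v U, (k w + 1) := by
      rw [Finset.sum_insert hv, ← Finset.add_sum_erase _ _ hu, ← Finset.add_sum_erase U _ hu,
        Finset.sum_congr rfl fun w hw => by
          rw [hk', Function.update_of_ne (Finset.ne_of_mem_erase hw)]]
      simp only [hk', Function.update_self]
      ring
    have hcontr : ∀ W ⊆ U, u ∈ W → G.indepSum a' (fun w => x * b' w) W =
        G.indepSum a (fun w => x * b w) (insert v W) := fun W hW huW => by
      rw [hxb]
      exact indepSum_contract_leaf huW (fun h => hv (hW h)) fun w hw => huv w (hW hw)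
    have hle : k u + k v + 2 ≤ ∑ w ∈ insert v U, (k w + 1) := by
      rw [Finset.sum_insert hv, ← Finset.add_sum_erase _ _ hu]
      omega
    have := ih (k := k') (a := a') (b := b') ?_ ?_ ?_
    · rwa [hcontr U subset_rfl hu, hsum] at this
    · intro W hW
      by_cases huW : u ∈ W
      · rw [hcontr W hW huW]
        exact hpos _ (Finset.insert_subset_insert _ hW)
      · rw [indepSum_congr (a' := a) (b' := fun w => x * b w)]
        · exact hpos W (hW.trans (Finset.subset_insert _ _))
        · exact fun w hw => Function.update_of_ne (ne_of_mem_of_not_mem hw huW) _ _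
        · intro w hw
          rw [hb', Function.update_of_ne (ne_of_mem_of_not_mem hw huW)]
    · intro w hw
      by_cases hwu : w = u
      · subst hwu
        simp only [hk', ha', hb', Function.update_self]
        refine (hQ w hmu).graft (hQ v hmv) hx ?_ fun j hj => hq j (hj.trans hle)
        simpa using hpos {v} (by simp)
      · simp only [hk', ha', hb', Function.update_of_ne hwu]
        exact hQ w (Finset.mem_insert_of_mem hw)
    · rw [hsum]
      exact hq

/-- Among trees of given order, the path has the largest values. -/
lemma LeafBuilt.eval_le_pathPoly {U : Finset V} (h : G.LeafBuilt U) (hx : x ≤ 0)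
    (hpos : ∀ U' ⊆ U, 0 < (G.indepPolyOn U').eval x) :
    (G.indepPolyOn U).eval x ≤ (pathPoly (U.card + 1)).eval x ∧
      ∀ j ≤ U.card + 1, 0 ≤ (pathPoly j).eval x := by
  -- The comparison needs nonnegative values only for paths shorter than |U|. It then makes the path
  -- on |U| vertices nonnegative as well, which feeds the next leaf step.
  have hstep : ∀ {U : Finset V}, G.LeafBuilt U →
      (∀ U' ⊆ U, 0 < (G.indepPolyOn U').eval x) →
      (∀ j ≤ U.card, 0 ≤ (pathPoly j).eval x) →
      (G.indepPolyOn U).eval x ≤ (pathPoly (U.card + 1)).eval x ∧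
        ∀ j ≤ U.card + 1, 0 ≤ (pathPoly j).eval x := by
    intro U h hpos hq
    have hle : (G.indepPolyOn U).eval x ≤ (pathPoly (U.card + 1)).eval x := by
      have := h.indepSum_le hx (k := fun _ => 0) (a := fun _ => 1) (b := fun _ => 1)
        (fun W hW => by simpa [eval_indepPolyOn] using hpos W hW)
        (fun v _ => pathDominated_zero x) (by simpa using hq)
      simpa [eval_indepPolyOn] using this
    refine ⟨hle, fun j hj => ?_⟩
    rcases Nat.le_succ_iff.1 hj with hj | rfl
    · exact hq j hj
    · exact (hpos U subset_rfl).le.trans hle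
  induction h with
  | single v =>
    refine hstep (.single v) hpos fun j hj => ?_
    rw [Finset.card_singleton] at hj
    interval_cases j <;> simp [pathPoly]
  | @addLeaf U u v hU hu hv huv ih =>
    refine hstep (.addLeaf hU hu hv huv) hpos ?_
    rw [Finset.card_insert_of_notMem hv]
    exact (ih fun U' hU' => hpos U' (hU'.trans (Finset.subset_insert _ _))).2

end

end SimpleGraph

namespace SimpleGraph

/-! ### The cases of equality -/

section Coeff

variable {V : Type*} [DecidableEq V] {G : SimpleGraph V}

lemma coeff_zero_indepPolyOn (U : Finset V) : (G.indepPolyOn U).coeff 0 = 1 := by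
  rw [coeff_zero_eq_eval_zero, eval_zero_indepPolyOn]

lemma coeff_one_indepPolyOn (U : Finset V) : (G.indepPolyOn U).coeff 1 = U.card := by
  classical
  induction U using Finset.induction_on with
  | empty => simp [coeff_one]
  | insert v U hv ih =>
    rw [indepPolyOn_insert hv, Finset.card_insert_of_notMem hv, coeff_add, ih, coeff_X_mul,
      coeff_zero_indepPolyOn]
    push_cast
    ring

lemma LeafBuilt.coeff_two {U : Finset V} (h : G.LeafBuilt U) :
    (G.indepPolyOn U).coeff 2 = ((U.card : ℝ) - 1) * (U.card - 2) / 2 := by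
  induction h with
  | single v => simp [coeff_one, coeff_X]
  | @addLeaf U u v hU hu hv huv ih =>
    have hc : ((U.erase u).card : ℝ) = U.card - 1 := by
      rw [Finset.card_erase_of_mem hu, Nat.cast_pred hU.card_pos]
    rw [indepPolyOn_insert_leaf hu hv huv, Finset.card_insert_of_notMem hv, coeff_add, ih,
      coeff_X_mul, coeff_one_indepPolyOn, hc]
    push_cast
    ring

-- The increment is the x^2 coefficient of I(U - u). Expanding I(U) at u, it is that of I(U), fixed
-- by |U|, minus the number of non-neighbours of u other than u itself.
open Classical in
lemma LeafBuilt.coeff_three_insert {U : Finset V} {u v : V} (hU : G.LeafBuilt U) (hu : u ∈ U)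
    (hv : v ∉ U) (huv : ∀ w ∈ U, G.Adj v w ↔ w = u) :
    (G.indepPolyOn (insert v U)).coeff 3 = (G.indepPolyOn U).coeff 3 +
      ((U.card : ℝ) - 1) * (U.card - 2) / 2 - (U.card - 1) + ({w ∈ U | G.Adj u w}.card : ℝ) := by
  have h2 := hU.coeff_two
  rw [indepPolyOn_eq_erase_add hu, coeff_add, coeff_X_mul, coeff_one_indepPolyOn] at h2
  have h3 : {w ∈ U.erase u | G.Adj u w} = {w ∈ U | G.Adj u w} := by
    ext w
    simp only [Finset.mem_filter, Finset.mem_erase]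
    exact ⟨fun h => ⟨h.1.2, h.2⟩, fun h => ⟨⟨h.2.ne', h.1⟩, h.2⟩⟩
  have h4 := Finset.card_filter_add_card_filter_not (s := U.erase u) (fun w => G.Adj u w)
  have hc : ((U.erase u).card : ℝ) = U.card - 1 := by
    rw [Finset.card_erase_of_mem hu, Nat.cast_pred hU.card_pos]
  rw [h3] at h4
  have h5 : ({w ∈ U | G.Adj u w}.card : ℝ) + {w ∈ U.erase u | ¬ G.Adj u w}.card =
      U.card - 1 := by
    rw [← hc, ← h4]
    push_cast
    ring
  rw [indepPolyOn_insert_leaf hu hv huv, coeff_add, coeff_X_mul]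
  linarith

lemma LeafBuilt.coeff_three_le {U : Finset V} (h : G.LeafBuilt U) :
    (G.indepPolyOn U).coeff 3 ≤ ((U.card : ℝ) - 1) * (U.card - 2) * (U.card - 3) / 6 ∧
    ((G.indepPolyOn U).coeff 3 = ((U.card : ℝ) - 1) * (U.card - 2) * (U.card - 3) / 6 →
      ∃ c ∈ U, ∀ w ∈ U, w ≠ c → G.Adj c w) := by
  classical
  induction h with
  | single v => simp [coeff_one, coeff_X]
  | @addLeaf U u v hU hu hv huv ih =>
    have hsub : {w ∈ U | G.Adj u w} ⊆ U.erase u := fun w hw =>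
      Finset.mem_erase.2 ⟨(Finset.mem_filter.1 hw).2.ne', (Finset.mem_filter.1 hw).1⟩
    have hc : ((U.erase u).card : ℝ) = U.card - 1 := by
      rw [Finset.card_erase_of_mem hu, Nat.cast_pred hU.card_pos]
    have hle : ({w ∈ U | G.Adj u w}.card : ℝ) ≤ U.card - 1 := by
      rw [← hc]
      exact_mod_cast Finset.card_le_card hsub
    rw [hU.coeff_three_insert hu hv huv, Finset.card_insert_of_notMem hv]
    push_cast
    have ih1 := ih.1
    -- Equality forces the attachment vertex of the last leaf to be adjacent to all of U, so it
    -- serves as the centre.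
    refine ⟨by linarith, fun heq => ⟨u, Finset.mem_insert_of_mem hu, fun w hw hwu => ?_⟩⟩
    rcases Finset.mem_insert.1 hw with rfl | hwU
    · exact ((huv u hu).2 rfl).symm
    have hge : (U.erase u).card ≤ {w ∈ U | G.Adj u w}.card := by
      rw [← Nat.cast_le (α := ℝ), hc]
      linarith
    have := Finset.eq_of_subset_of_card_le hsub hge
    have hmem : w ∈ {w ∈ U | G.Adj u w} := by
      rw [this]
      exact Finset.mem_erase.2 ⟨hwu, hwU⟩
    exact (Finset.mem_filter.1 hmem).2

lemma LeafBuilt.not_triangle {U : Finset V} (h : G.LeafBuilt U) {x y z : V} (hx : x ∈ U)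
    (hy : y ∈ U) (hz : z ∈ U) (hxy : G.Adj x y) (hyz : G.Adj y z) : ¬ G.Adj x z := by
  induction h with
  | single v =>
    rw [Finset.mem_singleton] at hx hy
    exact absurd (hx.trans hy.symm) hxy.ne
  | @addLeaf U u v hU hu hv huv ih =>
    intro hxz
    have hmem : ∀ {w}, w ∈ insert v U → w ≠ v → w ∈ U := fun h h' =>
      (Finset.mem_insert.1 h).resolve_left h'
    by_cases hxv : x = v
    · subst hxv
      have h1 := (huv y (hmem hy hxy.ne')).1 hxy
      have h2 := (huv z (hmem hz hxz.ne')).1 hxz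
      exact hyz.ne (h1.trans h2.symm)
    by_cases hyv : y = v
    · subst hyv
      have h1 := (huv x (hmem hx hxy.ne)).1 hxy.symm
      have h2 := (huv z (hmem hz hyz.ne')).1 hyz
      exact hxz.ne (h1.trans h2.symm)
    by_cases hzv : z = v
    · subst hzv
      have h1 := (huv x (hmem hx hxz.ne)).1 hxz.symm
      have h2 := (huv y (hmem hy hyz.ne)).1 hyz.symm
      exact hxy.ne (h1.trans h2.symm)
    exact ih (hmem hx hxv) (hmem hy hyv) (hmem hz hzv) hxz

lemma LeafBuilt.exists_adj {U : Finset V} (h : G.LeafBuilt U) (hU : 2 ≤ U.card) {u : V}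
    (hu : u ∈ U) : ∃ w ∈ U, G.Adj u w := by
  induction h with
  | single v => simp at hU
  | @addLeaf U c v hU' hc hv hcv ih =>
    have hvc : G.Adj v c := (hcv c hc).2 rfl
    rcases Finset.mem_insert.1 hu with rfl | huU
    · exact ⟨c, Finset.mem_insert_of_mem hc, hvc⟩
    by_cases huc : u = c
    · subst huc
      exact ⟨v, Finset.mem_insert_self _ _, hvc.symm⟩
    have h2 : 2 ≤ U.card := Finset.one_lt_card.2 ⟨u, huU, c, hc, huc⟩
    obtain ⟨w, hw, hadj⟩ := ih h2 huU
    exact ⟨w, Finset.mem_insert_of_mem hw, hadj⟩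

/-- The vertex set `U` induces a path. -/
def IsPathSet (G : SimpleGraph V) (U : Finset V) : Prop :=
  ∃ (m : ℕ) (e : ℕ → V), (∀ i < m, ∀ j < m, e i = e j → i = j) ∧
    (∀ w, w ∈ U ↔ ∃ i < m, e i = w) ∧
    ∀ i < m, ∀ j < m, G.Adj (e i) (e j) ↔ i + 1 = j ∨ j + 1 = i

open Classical in
lemma IsPathSet.insert_leaf {U : Finset V} (h : G.IsPathSet U) {u v : V} (hu : u ∈ U)
    (hv : v ∉ U) (huv : ∀ w ∈ U, G.Adj v w ↔ w = u) (hdeg : {w ∈ U | G.Adj u w}.card ≤ 1) :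
    G.IsPathSet (insert v U) := by
  -- The path can be enumerated so that u comes last: an interior vertex would have two neighbours,
  -- and if u comes first the enumeration is reversed.
  have key : ∃ (m : ℕ) (e : ℕ → V), (∀ i < m + 1, ∀ j < m + 1, e i = e j → i = j) ∧
      (∀ w, w ∈ U ↔ ∃ i < m + 1, e i = w) ∧
      (∀ i < m + 1, ∀ j < m + 1, G.Adj (e i) (e j) ↔ i + 1 = j ∨ j + 1 = i) ∧ e m = u := by
    obtain ⟨m, e, hinj, hmem, hadj⟩ := h
    obtain ⟨i, hi, hiu⟩ := (hmem u).1 hu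
    obtain ⟨m, rfl⟩ : ∃ m', m = m' + 1 := ⟨m - 1, by omega⟩
    by_cases him : i = m
    · exact ⟨m, e, hinj, hmem, hadj, him ▸ hiu⟩
    have hi0 : i = 0 := by
      by_contra hi0
      have h1 : e (i - 1) ∈ {w ∈ U | G.Adj u w} := Finset.mem_filter.2
        ⟨(hmem _).2 ⟨i - 1, by omega, rfl⟩, by
          rw [← hiu, hadj i hi (i - 1) (by omega)]; omega⟩
      have h2 : e (i + 1) ∈ {w ∈ U | G.Adj u w} := Finset.mem_filter.2
        ⟨(hmem _).2 ⟨i + 1, by omega, rfl⟩, by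
          rw [← hiu, hadj i hi (i + 1) (by omega)]; omega⟩
      have hlt := Finset.one_lt_card.2 ⟨_, h1, _, h2,
        fun h => by have := hinj _ (by omega) _ (by omega) h; omega⟩
      omega
    refine ⟨m, fun j => e (m - j), ?_, ?_, ?_, ?_⟩
    · intro i hi j hj h
      have := hinj _ (by omega) _ (by omega) h
      omega
    · intro w
      rw [hmem]
      constructor
      · rintro ⟨i, hi, rfl⟩
        exact ⟨m - i, by omega, by dsimp only; congr 1; omega⟩
      · rintro ⟨i, hi, rfl⟩
        exact ⟨m - i, by omega, rfl⟩
    · intro i hi j hj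
      rw [hadj _ (by omega) _ (by omega)]
      omega
    · simp [← hiu, hi0]
  obtain ⟨m, e, hinj, hmem, hadj, rfl⟩ := key
  have hne : ∀ i < m + 1, e i ≠ v := fun i hi h => hv ((hmem v).2 ⟨i, hi, h⟩)
  have hlt : ∀ {i}, i < m + 2 → i ≠ m + 1 → i < m + 1 := by omega
  have hve : ∀ i < m + 1, G.Adj v (e i) ↔ i = m := fun i hi =>
    (huv _ ((hmem _).2 ⟨i, hi, rfl⟩)).trans
      ⟨fun h => hinj _ hi _ (by omega) h, fun h => by rw [h]⟩
  refine ⟨m + 2, fun i => if i = m + 1 then v else e i, ?_, ?_, ?_⟩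
  · intro i hi j hj h
    dsimp only at h
    split_ifs at h with h1 h2 h2
    · omega
    · exact absurd h.symm (hne j (hlt hj h2))
    · exact absurd h (hne i (hlt hi h1))
    · exact hinj _ (hlt hi h1) _ (hlt hj h2) h
  · intro w
    rw [Finset.mem_insert, hmem]
    constructor
    · rintro (rfl | ⟨i, hi, rfl⟩)
      · exact ⟨m + 1, by omega, by simp⟩
      · exact ⟨i, by omega, by simp [hi.ne]⟩
    · rintro ⟨i, hi, rfl⟩
      dsimp only
      split_ifs with h1
      · exact Or.inl rfl
      · exact Or.inr ⟨i, hlt hi h1, rfl⟩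
  · intro i hi j hj
    dsimp only
    split_ifs with h1 h2 h2
    · simp only [SimpleGraph.irrefl, false_iff]
      omega
    · rw [hve j (hlt hj h2)]
      omega
    · rw [G.adj_comm, hve i (hlt hi h1)]
      omega
    · exact hadj _ (hlt hi h1) _ (hlt hj h2)

lemma coeff_zero_pathPoly (j : ℕ) : (pathPoly j).coeff 0 = 1 := by
  induction j using Nat.strong_induction_on with
  | _ j ih =>
  match j with
  | 0 => simp [pathPoly]
  | 1 => simp [pathPoly]
  | j + 2 => simp [pathPoly, ih (j + 1) (by omega)]

lemma coeff_one_pathPoly (j : ℕ) : (pathPoly (j + 1)).coeff 1 = j := by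
  induction j with
  | zero => simp [pathPoly, coeff_one]
  | succ j ih =>
    rw [pathPoly, coeff_add, ih, coeff_X_mul, coeff_zero_pathPoly]
    push_cast
    ring

lemma coeff_two_pathPoly (j : ℕ) :
    (pathPoly (j + 2)).coeff 2 = (j : ℝ) * (j - 1) / 2 := by
  induction j with
  | zero => simp [pathPoly, coeff_one, coeff_X]
  | succ j ih =>
    rw [pathPoly, coeff_add, ih, coeff_X_mul, coeff_one_pathPoly]
    push_cast
    ring

lemma LeafBuilt.coeff_three_ge {U : Finset V} (h : G.LeafBuilt U) :
    (pathPoly (U.card + 1)).coeff 3 ≤ (G.indepPolyOn U).coeff 3 ∧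
    ((G.indepPolyOn U).coeff 3 = (pathPoly (U.card + 1)).coeff 3 → G.IsPathSet U) := by
  classical
  induction h with
  | single v =>
    refine ⟨by simp [pathPoly, coeff_one, coeff_X], fun _ => ⟨1, fun _ => v, ?_, ?_, ?_⟩⟩
    · intro i hi j hj _
      omega
    · intro w
      simp [eq_comm]
    · intro i hi j hj
      simp only [SimpleGraph.irrefl, false_iff]
      omega
  | @addLeaf U u v hU hu hv huv ih =>
    have hpath : (pathPoly (U.card + 1 + 1)).coeff 3 =
        (pathPoly (U.card + 1)).coeff 3 + (pathPoly U.card).coeff 2 := by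
      rw [pathPoly, coeff_add, coeff_X_mul]
    rw [hU.coeff_three_insert hu hv huv, Finset.card_insert_of_notMem hv, hpath]
    obtain ⟨ih1, ih2⟩ := ih
    -- A single vertex has degree 0 in U; from two vertices on, connectedness gives degree at least
    -- 1, the value attained at a path end.
    obtain hc | hc := (show U.card = 1 ∨ 2 ≤ U.card from by have := hU.card_pos; omega)
    · have hempty : {w ∈ U | G.Adj u w} = ∅ := by
        obtain ⟨c, rfl⟩ := Finset.card_eq_one.1 hc
        rw [Finset.mem_singleton] at hu
        subst hu
        simp
      rw [hempty]
      simp only [hc, Nat.cast_one, Finset.card_empty, Nat.cast_zero] at ih1 ih2 ⊢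
      have h1 : (pathPoly 1).coeff 2 = 0 := by simp [pathPoly, coeff_one]
      rw [h1]
      refine ⟨by linarith, fun h => (ih2 (by linarith)).insert_leaf hu hv huv ?_⟩
      simp [hempty]
    · obtain ⟨j, hj⟩ := Nat.exists_eq_add_of_le' hc
      have h1 : (pathPoly U.card).coeff 2 = ((U.card : ℝ) - 2) * (U.card - 3) / 2 := by
        rw [hj, coeff_two_pathPoly]
        push_cast
        ring
      obtain ⟨w, hw, hadj⟩ := hU.exists_adj hc hu
      have hd : (1 : ℝ) ≤ ({w ∈ U | G.Adj u w}.card : ℝ) := by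
        exact_mod_cast Finset.card_pos.2 ⟨w, Finset.mem_filter.2 ⟨hw, hadj⟩⟩
      rw [h1]
      refine ⟨by linarith, fun h => (ih2 (by linarith)).insert_leaf hu hv huv ?_⟩
      rw [← Nat.cast_le (α := ℝ)]
      push_cast
      linarith

lemma coeff_three_star {n : ℕ} (hn : 0 < n) : (((1 + X) ^ (n - 1) + X : ℝ[X])).coeff 3 =
    ((n : ℝ) - 1) * (n - 2) * (n - 3) / 6 := by
  obtain ⟨m, rfl⟩ := Nat.exists_eq_succ_of_ne_zero hn.ne'
  have hch : ((m.choose 3 : ℕ) : ℝ) = (m : ℝ) * (m - 1) * (m - 2) / 6 := by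
    induction m with
    | zero => simp
    | succ m ih =>
      rw [Nat.choose_succ_succ' m 2]
      push_cast
      rw [ih (by omega), Nat.cast_choose_two]
      ring
  rw [Nat.succ_sub_one, coeff_add, coeff_one_add_X_pow, hch, coeff_X]
  push_cast
  norm_num
  ring

end Coeff

/-! ### Isomorphisms with the path and the star -/

section Iso

variable {V : Type*} [Fintype V] {G : SimpleGraph V}

lemma IsPathSet.nonempty_iso (h : G.IsPathSet Finset.univ) :
    Nonempty (G ≃g pathGraph (Fintype.card V)) := by
  obtain ⟨m, e, hinj, hmem, hadj⟩ := h
  let f : Fin m → V := fun i => e i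
  have hf : Function.Bijective f := by
    refine ⟨fun i j h => Fin.ext (hinj _ i.2 _ j.2 h), fun w => ?_⟩
    obtain ⟨i, hi, rfl⟩ := (hmem w).1 (Finset.mem_univ w)
    exact ⟨⟨i, hi⟩, rfl⟩
  have hm : m = Fintype.card V := by
    rw [← Fintype.card_of_bijective hf, Fintype.card_fin]
  subst hm
  refine ⟨(Iso.symm ⟨Equiv.ofBijective f hf, ?_⟩)⟩
  intro i j
  rw [pathGraph_adj]
  exact hadj _ i.2 _ j.2

lemma nonempty_iso_starOfOrder [DecidableEq V] {c : V} (hc : ∀ w, w ≠ c → G.Adj c w)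
    (hind : ∀ w w', w ≠ c → w' ≠ c → ¬ G.Adj w w') :
    Nonempty (G ≃g starOfOrder (Fintype.card V)) := by
  have h1 : Fintype.card {w // w = c} = 1 := Fintype.card_subtype_eq c
  have h2 : Fintype.card {w // ¬ w = c} = Fintype.card V - 1 := by
    rw [Fintype.card_subtype_compl, h1]
  let e : Fin 1 ⊕ Fin (Fintype.card V - 1) ≃ V :=
    ((Fintype.equivFinOfCardEq h1).symm.sumCongr (Fintype.equivFinOfCardEq h2).symm).trans
      (Equiv.sumCompl (· = c))
  have hl : ∀ i, e (Sum.inl i) = c := fun i => ((Fintype.equivFinOfCardEq h1).symm i).2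
  have hr : ∀ i, e (Sum.inr i) ≠ c := fun i => ((Fintype.equivFinOfCardEq h2).symm i).2
  refine ⟨Iso.symm ⟨e, ?_⟩⟩
  rintro (i | i) (j | j)
  · simp [hl]
  · simpa [hl] using hc _ (hr j)
  · simpa [hl] using (hc _ (hr i)).symm
  · simpa using hind _ _ (hr i) (hr j)

end Iso

end SimpleGraph

theorem mainTheorem1 {V : Type*} [Fintype V] (T : SimpleGraph V) (hT : T.IsTree)
    (n : ℕ) (hn : Fintype.card V = n) :
    -- each of the three largest real roots exists
    IsGreatest {x : ℝ | (SimpleGraph.starOfOrder n).indepPoly.IsRoot x}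
      (SimpleGraph.starOfOrder n).xi ∧
    IsGreatest {x : ℝ | T.indepPoly.IsRoot x} T.xi ∧
    IsGreatest {x : ℝ | (SimpleGraph.pathGraph n).indepPoly.IsRoot x}
      (SimpleGraph.pathGraph n).xi ∧
    -- the star is the maximum and the path is the minimum
    (SimpleGraph.starOfOrder n).IndepGE T ∧
    T.IndepGE (SimpleGraph.pathGraph n) ∧
    -- the cases of equality
    ((SimpleGraph.starOfOrder n).indepPoly = T.indepPoly ↔
      Nonempty (T ≃g SimpleGraph.starOfOrder n)) ∧
    (T.indepPoly = (SimpleGraph.pathGraph n).indepPoly ↔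
      Nonempty (T ≃g SimpleGraph.pathGraph n)) ∧
    -- the largest real roots
    T.xi ≤ (SimpleGraph.starOfOrder n).xi ∧
    (SimpleGraph.pathGraph n).xi ≤ T.xi := by
  classical
  subst hn
  have hne : Nonempty V := hT.connected.nonempty
  have hcard : 0 < Fintype.card V := Fintype.card_pos
  have : NeZero (Fintype.card V) := ⟨hcard.ne'⟩
  have hL := hT.leafBuilt_univ
  have hS := SimpleGraph.indepPoly_starOfOrder (Fintype.card V)
  have hP := SimpleGraph.indepPoly_pathGraph (Fintype.card V)
  have hTU := T.indepPoly_eq_indepPolyOn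
  have hstar : (SimpleGraph.starOfOrder (Fintype.card V)).IndepGE T :=
    -- Positivity is known for subgraphs of T, so the comparison is made on (ξ(T), 0], which then
    -- yields ξ(T) ≤ ξ(S_n).
    SimpleGraph.IndepGE.of_Ioc_right fun x hx => by
      have := hL.pow_add_le_eval hx.2 fun U _ => T.eval_indepPolyOn_pos hx.1 hx.2 U
      rw [hS, hTU]
      simpa using this
  have hpath : T.IndepGE (SimpleGraph.pathGraph (Fintype.card V)) :=
    SimpleGraph.IndepGE.of_Ioc fun x hx => by
      have := (hL.eval_le_pathPoly hx.2 fun U _ => T.eval_indepPolyOn_pos hx.1 hx.2 U).1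
      rw [hP, hTU]
      simpa using this
  refine ⟨SimpleGraph.isGreatest_xi _, T.isGreatest_xi, SimpleGraph.isGreatest_xi _, hstar, hpath,
    ⟨fun h => ?_, fun ⟨e⟩ => (SimpleGraph.indepPoly_congr e).symm⟩,
    ⟨fun h => ?_, fun ⟨e⟩ => SimpleGraph.indepPoly_congr e⟩, hstar.xi_le, hpath.xi_le⟩
  · rw [hS, hTU] at h
    obtain ⟨c, -, hc⟩ := hL.coeff_three_le.2 (by
      rw [← h, SimpleGraph.coeff_three_star hcard, Finset.card_univ])
    have hc' : ∀ w, w ≠ c → T.Adj c w := fun w => hc w (Finset.mem_univ w)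
    -- An edge between two non-central vertices would close a triangle with the centre.
    exact SimpleGraph.nonempty_iso_starOfOrder hc' fun w w' hw hw' hadj =>
      hL.not_triangle (Finset.mem_univ c) (Finset.mem_univ w) (Finset.mem_univ w') (hc' w hw)
        hadj (hc' w' hw')
  · rw [hP, hTU] at h
    exact (hL.coeff_three_ge.2 (by rw [h, Finset.card_univ])).nonempty_iso
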